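/- Let $\mathbf L$ be a finite (nonempty) algebra of finite signature such that (i) $\mathbf L$ is semilattice-based, i.e. one of its fundamental operations is a binary operation that is idempotent, commutative and associative, and (ii) $\mathbf L$ has a projection term, i.e. there is a binary term $x\triangleright y$, in which both variables occur, such that $x\triangleright y=y$ for all $x,y\in L$. Let $\flat(\mathbf L)$ denote the flat extension of $\mathbf L$ with distinguished $0$: its universe is the disjoint union $L\cup\{0\}$, its signature is that of $\mathbf L$ together with a new constant symbol denoting $0$ and a new binary operation symbol $\wedge$; each operation $f$ of $\mathbf L$ is extended by $f(x_1,\dots,x_n)=0$ whenever some $x_i=0$; and $x\wedge y=x$ if $x=y$, while $x\wedge y=0$ otherwise. Then there is a single first-order sentence $\varphi$ in the signature of $\flat(\mathbf L)$, in prenex form with quantifier prefix $\forall^*\exists^*\forall^*$, such that a finite algebra $\mathbf M$ of this signature belongs to the pseudovariety generated by $\flat(\mathbf L)$ (the smallest class of finite algebras that contains $\flat(\mathbf L)$ and is closed under homomorphic images, subalgebras and finite direct products) if and only if $\mathbf M\models\varphi$. -/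

import Mathlib

universe u v w

namespace FlatFO

open scoped FirstOrder
open FirstOrder.Language

section Signatures

/-- The two symbols added to a signature by the flat extension: the distinguished constant `0`
and the binary operation `∧`. -/
inductive FlatOp : ℕ → Type
  | zero : FlatOp 0
  | meet : FlatOp 2

/-- The signature `{0, ∧}`. -/
def flatOps : FirstOrder.Language.{0, 0} := ⟨FlatOp, fun _ => Empty⟩

instance : flatOps.IsAlgebraic := fun _ => inferInstanceAs (IsEmpty Empty)

/-- The signature of the flat extensions with distinguished `0` of algebras of signature `S`:
the disjoint union of `S` and `{0, ∧}`. -/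
abbrev flatLanguage (S : FirstOrder.Language.{u, v}) : FirstOrder.Language.{u, v} := S.sum flatOps

end Signatures

section FlatExtension

/-- The universe `A ∪ {0}` (disjoint union) of the flat extension of `A`. -/
def Flat (A : Type w) : Type w := Option A

/-- The added element `0`. -/
def Flat.zero {A : Type w} : Flat A := (none : Option A)

/-- The inclusion of `A` into `A ∪ {0}`. -/
def Flat.of {A : Type w} (a : A) : Flat A := (some a : Option A)

open Classical in
/-- The operation of the flat extension that interprets a symbol `f` of the original signature:
it is the operation of `A` on tuples of elements of `A`, and `0` as soon as some argument is `0`.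
(In particular the interpretation of a constant symbol does not change.) -/
noncomputable def flatFun {S : FirstOrder.Language.{u, v}} {A : Type w} [S.Structure A] {n : ℕ}
    (f : S.Functions n) (x : Fin n → Flat A) : Flat A :=
  if h : ∃ a : Fin n → A, ∀ i, x i = Flat.of (a i) then
    Flat.of (Structure.funMap f h.choose)
  else Flat.zero

open Classical in
/-- The interpretation of the added symbols: `0` is the added element, and `x ∧ y` is `x` if
`x = y` and `0` otherwise. -/
noncomputable def flatOpFun {A : Type w} : {n : ℕ} → FlatOp n → (Fin n → Flat A) → Flat A
  | _, FlatOp.zero, _ => Flat.zero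
  | _, FlatOp.meet, x => if x 0 = x 1 then x 0 else Flat.zero

/-- The flat extension of the algebra `A`, with `0` distinguished. -/
noncomputable instance flatStructure {S : FirstOrder.Language.{u, v}} [S.IsAlgebraic] {A : Type w}
    [S.Structure A] : (flatLanguage S).Structure (Flat A) where
  funMap {_} f x := Sum.elim (fun g => flatFun g x) (fun g => flatOpFun g x) f
  RelMap {_} r _ := isEmptyElim r

theorem Flat.of_injective {A : Type w} : Function.Injective (Flat.of : A → Flat A) :=
  Option.some_injective A

theorem Flat.of_ne_zero {A : Type w} (a : A) : Flat.of a ≠ Flat.zero :=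
  Option.some_ne_none a

theorem flatFun_of {S : FirstOrder.Language.{u, v}} {A : Type w} [S.Structure A] {n : ℕ}
    (f : S.Functions n) (a : Fin n → A) :
    flatFun f (fun i => Flat.of (a i)) = Flat.of (Structure.funMap f a) := by
  have h : ∃ b : Fin n → A, ∀ i, Flat.of (a i) = Flat.of (b i) := ⟨a, fun _ => rfl⟩
  have hb : h.choose = a := funext fun i => (Flat.of_injective (h.choose_spec i)).symm
  unfold flatFun
  rw [dif_pos h, hb]

theorem flatFun_zero {S : FirstOrder.Language.{u, v}} {A : Type w} [S.Structure A] {n : ℕ}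
    (f : S.Functions n) (x : Fin n → Flat A) (i : Fin n) (hi : x i = Flat.zero) :
    flatFun f x = Flat.zero := by
  unfold flatFun
  rw [dif_neg]
  rintro ⟨a, ha⟩
  exact Flat.of_ne_zero (a i) ((ha i).symm.trans hi)

end FlatExtension

section AlgebraicConditions

/-- An algebra is semilattice-based if one of its fundamental operations is a binary operation
satisfying the semilattice axioms. -/
def IsSemilatticeBased (S : FirstOrder.Language.{u, v}) (A : Type w) [S.Structure A] : Prop :=
  ∃ s : S.Functions 2,
    (∀ a : A, Structure.funMap s ![a, a] = a) ∧
    (∀ a b : A, Structure.funMap s ![a, b] = Structure.funMap s ![b, a]) ∧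
    (∀ a b c : A, Structure.funMap s ![a, Structure.funMap s ![b, c] ] =
      Structure.funMap s ![Structure.funMap s ![a, b], c])

/-- `A` has a projection term: a binary term `t(x, y)`, in which both variables occur, that
satisfies `t(x, y) = y` on `A`. (If `x` were not required to occur, then the term `y` would
be a projection term of every algebra.) -/
def HasProjectionTerm (S : FirstOrder.Language.{u, v}) (A : Type w) [S.Structure A] : Prop :=
  ∃ t : S.Term (Fin 2), (∀ i : Fin 2, i ∈ t.varFinset) ∧ ∀ a b : A, t.realize ![a, b] = b

end AlgebraicConditions

section Pseudovarieties

/-- The direct product of a family of structures: everything is computed coordinatewise. -/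
instance piStructure {S : FirstOrder.Language.{u, v}} {ι : Type*} (M : ι → Type w)
    [∀ i, S.Structure (M i)] : S.Structure (∀ i, M i) where
  funMap f x := fun i => Structure.funMap f (fun j => x j i)
  RelMap r x := ∀ i, Structure.RelMap r (fun j => x j i)

/-- A pseudovariety: a class of finite (nonempty) algebras closed under homomorphic images,
subalgebras and finitary direct products. -/
structure IsPseudovariety (S : FirstOrder.Language.{u, v}) (K : ∀ (M : Type w) [S.Structure M], Prop) :
    Prop where
  finite : ∀ (M : Type w) [S.Structure M], K M → Finite M
  nonempty : ∀ (M : Type w) [S.Structure M], K M → Nonempty M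
  hom : ∀ (M N : Type w) [S.Structure M] [S.Structure N] (f : M →[S] N),
    Function.Surjective f → K M → K N
  sub : ∀ (M : Type w) [S.Structure M] (B : S.Substructure M), Nonempty B → K M → K B
  prod : ∀ (n : ℕ) (M : Fin n → Type w) [∀ i, S.Structure (M i)],
    (∀ i, K (M i)) → K (∀ i, M i)

/-- `M` belongs to the pseudovariety generated by the algebra `A`, which is the least
pseudovariety that contains `A`. -/
def MemPseudovariety (S : FirstOrder.Language.{u, v}) (A : Type w) [S.Structure A]
    (M : Type w) [S.Structure M] : Prop :=
  ∀ K : (∀ (N : Type w) [S.Structure N], Prop), IsPseudovariety S K → K A → K M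

end Pseudovarieties

section Prefixes

/-- Prenex formulas with quantifier prefix `∃*∀*`. -/
inductive IsEA {S : FirstOrder.Language.{u, v}} {α : Type w} : ∀ {n : ℕ}, S.BoundedFormula α n → Prop
  | of_isUniversal {n : ℕ} {φ : S.BoundedFormula α n} (h : φ.IsUniversal) : IsEA φ
  | ex {n : ℕ} {φ : S.BoundedFormula α (n + 1)} (h : IsEA φ) : IsEA φ.ex

/-- Prenex formulas with quantifier prefix `∀*∃*∀*`. -/
inductive IsAEA {S : FirstOrder.Language.{u, v}} {α : Type w} : ∀ {n : ℕ}, S.BoundedFormula α n → Prop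
  | of_isEA {n : ℕ} {φ : S.BoundedFormula α n} (h : IsEA φ) : IsAEA φ
  | all {n : ℕ} {φ : S.BoundedFormula α (n + 1)} (h : IsAEA φ) : IsAEA φ.all

end Prefixes

end FlatFO

/-! A finite algebra lies in the pseudovariety exactly when it satisfies the identities of `Flat L`
(`memPseudovariety_iff`), so the task is to express these infinitely many identities by one
sentence.

In `Flat L` the projection term x ▷ y is y if x ≠ 0 and 0 if x = 0 (`guard_flat`). In M, read x ▷ p
= p as "x is above p", meaning that x is nonzero wherever p is. For p ≠ 0, consider maps M → L ∪ {0}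
that are nonzero exactly above p, commute with the operations of L, and give x, y and x ∧ y the same
value whenever x ∧ y is above p. If such maps exist, and separate any two elements above p whose
meet is not above p, then an identity of `Flat L` cannot fail in M: taking p to be a nonzero value
of one side, the maps force the other side, and then the meet of both, above p (`guard_realize_eq`,
`Separable.realize_eq`).

Conversely, in a finite model M of the identities, the requirements on such a map can be packed into
one term with value p ≠ 0. Were there no suitable valuation in `Flat L`, an identity would force p =
0 or contradict the separation requirement (`IsModel.exists_valuation`).

A map on M is a second-order object; the semilattice operation makes it first-order. On the elements
x above p with p ▷ x = x, each fibre over k ∈ L is closed under that operation, hence has a least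
element m k if it is nonempty, and for x above p the value at x is the greatest k with m k ≠ 0 and m
k ≤ x (`IsModel.exists_isGood`). So |L| elements of M encode the map. Saying "for all p, z, w there
are parameters m such that the coded map is good and separates z and w" is the ∀*∃*∀* condition
`Separable`; goodness is a universal condition because L and the signature are finite. -/

namespace FlatFO

/-! ### Quantifier-free definable properties and quantifier blocks. -/

section Definability

open FirstOrder FirstOrder.Language

variable {Λ : FirstOrder.Language.{u, v}} {V : Type*}

/-- A property of tuples of elements of `Λ`-structures is quantifier-free definable if it is
defined by a quantifier-free formula. -/
def QFDefinable (Λ : FirstOrder.Language.{u, v}) {V : Type*}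
    (R : ∀ (M : Type w) [Λ.Structure M], (V → M) → Prop) : Prop :=
  ∃ θ : Λ.Formula V, θ.IsQF ∧ ∀ (M : Type w) [Λ.Structure M] (a : V → M), θ.Realize a ↔ R M a

namespace QFDefinable

variable {R R' : ∀ (M : Type w) [Λ.Structure M], (V → M) → Prop}

theorem congr (h : QFDefinable Λ R)
    (e : ∀ (M : Type w) [Λ.Structure M] (a : V → M), R M a ↔ R' M a) : QFDefinable Λ R' := by
  obtain ⟨θ, hθ, h⟩ := h
  exact ⟨θ, hθ, fun M _ a => (h M a).trans (e M a)⟩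

theorem equal (t t' : Λ.Term V) :
    QFDefinable.{u, v, w} Λ (fun _ _ a => t.realize a = t'.realize a) :=
  ⟨t.equal t', (BoundedFormula.IsAtomic.equal _ _).isQF, fun _ _ _ => Formula.realize_equal⟩

theorem const (P : Prop) : QFDefinable.{u, v, w} Λ (fun _ _ (_ : V → _) => P) := by
  by_cases h : P
  · exact ⟨⊤, BoundedFormula.IsQF.top, fun _ _ _ => by simp [h]⟩
  · exact ⟨⊥, BoundedFormula.isQF_bot, fun _ _ _ => by simp [h]⟩

theorem imp (h : QFDefinable Λ R) (h' : QFDefinable Λ R') :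
    QFDefinable Λ (fun M _ a => R M a → R' M a) := by
  obtain ⟨θ, hθ, h⟩ := h
  obtain ⟨θ', hθ', h'⟩ := h'
  exact ⟨θ.imp θ', hθ.imp hθ', fun M _ a => by simp [h, h']⟩

theorem not (h : QFDefinable Λ R) : QFDefinable Λ (fun M _ a => ¬ R M a) :=
  (h.imp (const False)).congr fun _ _ _ => Iff.rfl

theorem and (h : QFDefinable Λ R) (h' : QFDefinable Λ R') :
    QFDefinable Λ (fun M _ a => R M a ∧ R' M a) :=
  (h.imp h'.not).not.congr fun _ _ _ => by tauto

theorem iff (h : QFDefinable Λ R) (h' : QFDefinable Λ R') :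
    QFDefinable Λ (fun M _ a => R M a ↔ R' M a) :=
  ((h.imp h').and (h'.imp h)).congr fun _ _ _ => by tauto

theorem forall_finite {I : Type*} [Finite I]
    {P : I → ∀ (M : Type w) [Λ.Structure M], (V → M) → Prop}
    (h : ∀ i, QFDefinable Λ (P i)) : QFDefinable Λ (fun M _ a => ∀ i, P i M a) := by
  classical
  cases nonempty_fintype I
  have key : ∀ s : Finset I, QFDefinable Λ (fun M _ a => ∀ i ∈ s, P i M a) := by
    intro s
    induction s using Finset.induction_on with
    | empty => exact (const True).congr (by simp)
    | insert i s _ ih => exact ((h i).and ih).congr (by simp)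
  exact (key Finset.univ).congr (by simp)

/-- Boolean combinations of finitely many quantifier-free definable properties are
quantifier-free definable. -/
theorem boolean {I : Type*} [Finite I]
    {P : I → ∀ (M : Type w) [Λ.Structure M], (V → M) → Prop}
    (h : ∀ i, QFDefinable Λ (P i)) (B : Set I → Prop) :
    QFDefinable Λ (fun M _ a => B {i | P i M a}) := by
  -- There are only finitely many truth patterns `X`; for each one, the formula says that if the
  -- pattern is realised then `B X` holds.
  refine (forall_finite (I := Set I) fun X =>
    (forall_finite fun i => (h i).iff (const (i ∈ X))).imp (const (B X))).congr fun M _ a => ?_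
  constructor
  · intro H
    exact H _ fun i => Iff.rfl
  · intro H X hX
    have : {i | P i M a} = X := Set.ext hX
    rwa [← this]

end QFDefinable

/-- Universal quantification over the last `c` variables. -/
def allsLast {α : Type*} : ∀ (c : ℕ) {n : ℕ}, Λ.BoundedFormula α (n + c) → Λ.BoundedFormula α n
  | 0, _, φ => φ
  | c + 1, _, φ => allsLast c φ.all

/-- Existential quantification over the last `c` variables. -/
def exsLast {α : Type*} : ∀ (c : ℕ) {n : ℕ}, Λ.BoundedFormula α (n + c) → Λ.BoundedFormula α n
  | 0, _, φ => φ
  | c + 1, _, φ => exsLast c φ.ex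

theorem realize_allsLast {α : Type*} {M : Type*} [Λ.Structure M] {c n : ℕ}
    (φ : Λ.BoundedFormula α (n + c)) (a : α → M) (xs : Fin n → M) :
    (allsLast c φ).Realize a xs ↔ ∀ y : Fin c → M, φ.Realize a (Fin.append xs y) := by
  induction c with
  | zero => simp [allsLast, Fin.append_right_nil _ _ rfl]
  | succ c ih =>
    rw [allsLast, ih]
    simp only [BoundedFormula.realize_all]
    constructor
    · intro h y
      rw [← Fin.snoc_init_self y, Fin.append_snoc]
      exact h _ _
    · intro h y b
      rw [← Fin.append_snoc]
      exact h _

theorem realize_exsLast {α : Type*} {M : Type*} [Λ.Structure M] {c n : ℕ}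
    (φ : Λ.BoundedFormula α (n + c)) (a : α → M) (xs : Fin n → M) :
    (exsLast c φ).Realize a xs ↔ ∃ y : Fin c → M, φ.Realize a (Fin.append xs y) := by
  induction c with
  | zero => simp [exsLast, Fin.append_right_nil _ _ rfl, Unique.exists_iff]
  | succ c ih =>
    rw [exsLast, ih]
    simp only [BoundedFormula.realize_ex]
    constructor
    · rintro ⟨y, b, h⟩
      rw [← Fin.append_snoc] at h
      exact ⟨_, h⟩
    · rintro ⟨y, h⟩
      rw [← Fin.snoc_init_self y, Fin.append_snoc] at h
      exact ⟨_, _, h⟩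

theorem isUniversal_allsLast {α : Type*} {c n : ℕ} {φ : Λ.BoundedFormula α (n + c)}
    (h : φ.IsUniversal) : (allsLast c φ).IsUniversal := by
  induction c with
  | zero => exact h
  | succ c ih => exact ih h.all

theorem isEA_exsLast {α : Type*} {c n : ℕ} {φ : Λ.BoundedFormula α (n + c)}
    (h : IsEA φ) : IsEA (exsLast c φ) := by
  induction c with
  | zero => exact h
  | succ c ih => exact ih h.ex

theorem isAEA_allsLast {α : Type*} {c n : ℕ} {φ : Λ.BoundedFormula α (n + c)}
    (h : IsAEA φ) : IsAEA (allsLast c φ) := by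
  induction c with
  | zero => exact h
  | succ c ih => exact ih h.all

/-- A quantifier-free definable property preceded by a finite block `∀*∃*∀*` of quantifiers is
expressed by a sentence of that form. -/
theorem QFDefinable.exists_isAEA {X Y Z : Type*} [Finite X] [Finite Y] [Finite Z]
    {R : ∀ (M : Type w) [Λ.Structure M], (X ⊕ Y ⊕ Z → M) → Prop} (h : QFDefinable Λ R) :
    ∃ φ : Λ.Sentence, IsAEA φ ∧ ∀ (M : Type w) [Λ.Structure M], M ⊨ φ ↔
      ∀ x : X → M, ∃ y : Y → M, ∀ z : Z → M, R M (Sum.elim x (Sum.elim y z)) := by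
  obtain ⟨θ, hθ, h⟩ := h
  obtain ⟨a, ⟨eX⟩⟩ := Finite.exists_equiv_fin X
  obtain ⟨b, ⟨eY⟩⟩ := Finite.exists_equiv_fin Y
  obtain ⟨c, ⟨eZ⟩⟩ := Finite.exists_equiv_fin Z
  -- All free variables become de Bruijn variables in three consecutive blocks; the leading 0 is the
  -- empty context of a sentence.
  let g : X ⊕ Y ⊕ Z → Empty ⊕ Fin (0 + a + b + c) := fun i => Sum.inr
    (Sum.elim (fun x => Fin.castAdd c (Fin.castAdd b (Fin.natAdd 0 (eX x))))
      (Sum.elim (fun y => Fin.castAdd c (Fin.natAdd (0 + a) (eY y)))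
        (fun z => Fin.natAdd (0 + a + b) (eZ z))) i)
  let ψ : Λ.BoundedFormula Empty (0 + a + b + c) := BoundedFormula.relabel g θ
  have hψ : ψ.IsQF := hθ.relabel g
  refine ⟨allsLast a (exsLast b (allsLast c ψ)),
    isAEA_allsLast (.of_isEA (isEA_exsLast (.of_isUniversal (isUniversal_allsLast hψ.isUniversal)))),
    fun M _ => ?_⟩
  have key : ∀ (x : Fin a → M) (y : Fin b → M) (z : Fin c → M),
      ψ.Realize default (Fin.append (Fin.append (Fin.append default x) y) z) ↔
        R M (Sum.elim (x ∘ eX) (Sum.elim (y ∘ eY) (z ∘ eZ))) := by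
    intro x y z
    rw [← h]
    simp only [ψ]
    rw [BoundedFormula.realize_relabel, Formula.Realize]
    refine iff_of_eq (congrArg₂ _ ?_ (Subsingleton.elim _ _))
    funext i
    rcases i with i | i | i
    · change Fin.append (Fin.append (Fin.append default x) y) z
        (Fin.castAdd c (Fin.castAdd b (Fin.natAdd 0 (eX i)))) = _
      simp only [Fin.append_left, Fin.append_right]
      rfl
    · change Fin.append (Fin.append (Fin.append default x) y) z
        (Fin.castAdd c (Fin.natAdd (0 + a) (eY i))) = _
      simp only [Fin.append_left, Fin.append_right]
      rfl
    · change Fin.append (Fin.append (Fin.append default x) y) z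
        (Fin.natAdd (0 + a + b) (eZ i)) = _
      simp only [Fin.append_right]
      rfl
  rw [Sentence.Realize, Formula.Realize, realize_allsLast]
  simp only [realize_exsLast, realize_allsLast, key]
  refine ((eX.symm.arrowCongr (Equiv.refl M)).forall_congr fun {x} => ?_)
  refine ((eY.symm.arrowCongr (Equiv.refl M)).exists_congr fun {y} => ?_)
  refine ((eZ.symm.arrowCongr (Equiv.refl M)).forall_congr fun {z} => ?_)
  exact Iff.rfl

end Definability

/-! ### Finite form of Birkhoff's theorem. -/

section Identities

open FirstOrder FirstOrder.Language

variable {Λ : FirstOrder.Language.{u, v}}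

/-- Every identity of `A` holds in `M`. -/
def SatisfiesIdentities (Λ : FirstOrder.Language.{u, v}) (A : Type w) [Λ.Structure A]
    (M : Type w) [Λ.Structure M] : Prop :=
  ∀ (α : Type w) (t t' : Λ.Term α), (∀ a : α → A, t.realize a = t'.realize a) →
    ∀ a : α → M, t.realize a = t'.realize a

/-- A projection of a direct product. -/
def projHom {ι : Type*} (M : ι → Type w) [∀ i, Λ.Structure (M i)] (i : ι) :
    (∀ i, M i) →[Λ] M i where
  toFun x := x i
  map_fun' _ _ := rfl
  map_rel' _ _ h := h i

theorem realize_pi {ι : Type*} {M : ι → Type w} [∀ i, Λ.Structure (M i)] {α : Type*}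
    (t : Λ.Term α) (a : α → ∀ i, M i) (i : ι) :
    t.realize a i = t.realize fun k => a k i :=
  (HomClass.realize_term (projHom M i) (t := t) (v := a)).symm

/-- Identities survive images (lift the valuation), subalgebras and products; this makes them
necessary conditions for membership in the generated pseudovariety. -/
theorem isPseudovariety_satisfiesIdentities (A : Type w) [Λ.Structure A] :
    IsPseudovariety Λ (fun (M : Type w) [Λ.Structure M] =>
      Finite M ∧ Nonempty M ∧ SatisfiesIdentities Λ A M) where
  finite _ _ h := h.1
  nonempty _ _ h := h.2.1
  hom M N _ _ f hf h := by
    obtain ⟨_, ⟨x⟩, h⟩ := h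
    refine ⟨Finite.of_surjective f hf, ⟨f x⟩, fun α t t' e a => ?_⟩
    have ha : a = f ∘ (fun k => (hf (a k)).choose) := funext fun k => (hf (a k)).choose_spec.symm
    rw [ha, HomClass.realize_term f, HomClass.realize_term f, h α t t' e]
  sub M _ B hB h := by
    obtain ⟨_, _, h⟩ := h
    refine ⟨inferInstance, hB, fun α t t' e a => B.subtype_injective ?_⟩
    have := h α t t' e (B.subtype ∘ a)
    rwa [HomClass.realize_term B.subtype, HomClass.realize_term B.subtype] at this
  prod n M _ h := by
    refine ⟨@Pi.finite _ _ _ fun i => (h i).1, ⟨fun i => (h i).2.1.some⟩,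
      fun α t t' e a => funext fun i => ?_⟩
    rw [realize_pi, realize_pi, (h i).2.2 α t t' e]

/-- The finite members of the pseudovariety generated by a finite algebra are its finite models
of identities. -/
theorem memPseudovariety_iff [Λ.IsAlgebraic] (A : Type w) [Λ.Structure A] [Finite A] [Nonempty A]
    (M : Type w) [Λ.Structure M] [Finite M] [Nonempty M] :
    MemPseudovariety Λ A M ↔
      ∀ t t' : Λ.Term M, (∀ a : M → A, t.realize a = t'.realize a) →
        t.realize id = t'.realize id := by
  constructor
  · intro h t t' e
    exact (h _ (isPseudovariety_satisfiesIdentities A)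
      ⟨inferInstance, inferInstance, fun α t t' e => e⟩).2.2 M t t' e id
  · intro h K hK hA
    obtain ⟨n, ⟨e⟩⟩ := Finite.exists_equiv_fin (M → A)
    -- The tuple of values of a term under all valuations M → A. Its range `B` is the relatively
    -- free algebra on M, a subalgebra of a finite power of A.
    let ev : Λ.Term M → Fin n → A := fun t i => t.realize (e.symm i)
    let B : Λ.Substructure (Fin n → A) :=
      { carrier := Set.range ev
        fun_mem := fun f x hx => by
          choose t ht using hx
          exact ⟨Term.func f t, funext fun i => congrArg (Structure.funMap f)
            (funext fun j => congrFun (ht j) i)⟩ }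
    -- Equal tuples mean an identity of A, so evaluation in M does not depend on the term chosen to
    -- represent an element of `B`.
    have hev : ∀ t t' : Λ.Term M, ev t = ev t' → t.realize id = t'.realize id := by
      intro t t' htt
      refine h t t' fun a => ?_
      simpa [ev] using congrFun htt (e a)
    let f : B →[Λ] M :=
      { toFun := fun x => (x.2.choose).realize id
        map_fun' := fun {k} g x => by
          have : (Structure.funMap g x : B).2.choose.realize id =
              (Term.func g fun j => (x j).2.choose).realize id := by
            refine hev _ _ ((Structure.funMap g x : B).2.choose_spec.trans ?_)
            funext i
            exact congrArg (Structure.funMap g)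
              (funext fun j => (congrFun (x j).2.choose_spec i).symm)
          exact this
        map_rel' := fun r => isEmptyElim r }
    have hf : Function.Surjective f := by
      intro m
      refine ⟨⟨ev (Term.var m), _, rfl⟩, ?_⟩
      exact hev _ (Term.var m) (⟨ev (Term.var m), _, rfl⟩ : B).2.choose_spec
    have hB : Nonempty B := ⟨⟨ev (Term.var (Classical.arbitrary M)), _, rfl⟩⟩
    exact hK.hom B M f hf (hK.sub _ B hB (hK.prod n (fun _ => A) fun _ => hA))

end Identities

/-! ### Operations and terms of the extended signature, and their values in the flat extension. -/

section Operations

open FirstOrder FirstOrder.Language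

variable {S : FirstOrder.Language.{u, v}}

/-- An operation symbol of `S`, as a symbol of the signature of the flat extensions. -/
def opSym {n : ℕ} (f : S.Functions n) : (flatLanguage S).Functions n := Sum.inl f

/-- The symbol `0`. -/
def zeroSym (S : FirstOrder.Language.{u, v}) : (flatLanguage S).Functions 0 := Sum.inr FlatOp.zero

/-- The symbol `∧`. -/
def meetSym (S : FirstOrder.Language.{u, v}) : (flatLanguage S).Functions 2 := Sum.inr FlatOp.meet

section

variable {M : Type*} [(flatLanguage S).Structure M]

/-- The value of the symbol `0`. -/
def zeroOp (S : FirstOrder.Language.{u, v}) (M : Type*) [(flatLanguage S).Structure M] : M :=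
  Structure.funMap (zeroSym S) default

/-- The operation `∧`. -/
def meetOp (S : FirstOrder.Language.{u, v}) {M : Type*} [(flatLanguage S).Structure M]
    (x y : M) : M :=
  Structure.funMap (meetSym S) ![x, y]

/-- A binary operation of `S` in an algebra of the larger signature. -/
def binOp (s : S.Functions 2) (x y : M) : M := Structure.funMap (opSym s) ![x, y]

/-- The operation of a binary term over `S` in an algebra of the larger signature. -/
def guard (t : S.Term (Fin 2)) (x y : M) : M :=
  ((LHom.sumInl : S →ᴸ flatLanguage S).onTerm t).realize ![x, y]

theorem realize_zeroSym {α : Type*} (ts : Fin 0 → (flatLanguage S).Term α) (a : α → M) :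
    (Term.func (zeroSym S) ts).realize a = zeroOp S M :=
  congrArg (Structure.funMap (zeroSym S)) (Subsingleton.elim _ _)

theorem realize_meetSym {α : Type*} (ts : Fin 2 → (flatLanguage S).Term α) (a : α → M) :
    (Term.func (meetSym S) ts).realize a = meetOp S ((ts 0).realize a) ((ts 1).realize a) :=
  congrArg (Structure.funMap (meetSym S)) (funext (Fin.forall_fin_two.2 ⟨rfl, rfl⟩))

/-- The term `r ∧ r'`. -/
def meetTerm {α : Type*} (r r' : (flatLanguage S).Term α) : (flatLanguage S).Term α :=
  Term.func (meetSym S) ![r, r']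

/-- The term `s(r, r')` for a binary symbol `s` of `S`. -/
def binTerm {α : Type*} (s : S.Functions 2) (r r' : (flatLanguage S).Term α) :
    (flatLanguage S).Term α :=
  Term.func (opSym s) ![r, r']

/-- The constant term `0`. -/
def zeroTerm (S : FirstOrder.Language.{u, v}) (α : Type*) : (flatLanguage S).Term α :=
  Term.func (zeroSym S) default

/-- The term `t(r, r')` for a binary term `t` over `S`. -/
def guardTerm {α : Type*} (t : S.Term (Fin 2)) (r r' : (flatLanguage S).Term α) :
    (flatLanguage S).Term α :=
  ((LHom.sumInl : S →ᴸ flatLanguage S).onTerm t).subst ![r, r']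

theorem realize_meetTerm {α : Type*} (r r' : (flatLanguage S).Term α) (a : α → M) :
    (meetTerm r r').realize a = meetOp S (r.realize a) (r'.realize a) :=
  realize_meetSym _ _

theorem realize_binTerm {α : Type*} (s : S.Functions 2) (r r' : (flatLanguage S).Term α)
    (a : α → M) : (binTerm s r r').realize a = binOp s (r.realize a) (r'.realize a) :=
  congrArg (Structure.funMap (opSym s)) (funext (Fin.forall_fin_two.2 ⟨rfl, rfl⟩))

theorem realize_zeroTerm {α : Type*} (a : α → M) : (zeroTerm S α).realize a = zeroOp S M :=
  realize_zeroSym _ _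

theorem realize_guardTerm {α : Type*} (t : S.Term (Fin 2)) (r r' : (flatLanguage S).Term α)
    (a : α → M) : (guardTerm t r r').realize a = guard t (r.realize a) (r'.realize a) := by
  rw [guardTerm, Term.realize_subst, guard]
  congr 1
  exact funext (Fin.forall_fin_two.2 ⟨rfl, rfl⟩)

end

section

variable {L : Type w} [S.Structure L]

theorem Flat.eq_zero_or_of (x : Flat L) : x = Flat.zero ∨ ∃ a, x = Flat.of a := by
  rcases x with _ | a
  · exact .inl rfl
  · exact .inr ⟨a, rfl⟩

theorem Flat.ne_zero_iff {x : Flat L} : x ≠ Flat.zero ↔ ∃ a, x = Flat.of a := by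
  constructor
  · exact fun h => x.eq_zero_or_of.resolve_left h
  · rintro ⟨a, rfl⟩
    exact Flat.of_ne_zero a

theorem flatFun_ne_zero_iff {n : ℕ} (f : S.Functions n) (x : Fin n → Flat L) :
    flatFun f x ≠ Flat.zero ↔ ∀ i, x i ≠ Flat.zero := by
  constructor
  · exact fun h i hi => h (flatFun_zero f x i hi)
  · intro h
    choose a ha using fun i => Flat.ne_zero_iff.1 (h i)
    obtain rfl : x = fun i => Flat.of (a i) := funext ha
    rw [flatFun_of]
    exact Flat.of_ne_zero _

variable [S.IsAlgebraic]

theorem funMap_opSym_flat {n : ℕ} (f : S.Functions n) (x : Fin n → Flat L) :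
    Structure.funMap (opSym f) x = flatFun f x := rfl

theorem zeroOp_flat : zeroOp S (Flat L) = Flat.zero := rfl

open Classical in
theorem meetOp_flat (x y : Flat L) : meetOp S x y = if x = y then x else Flat.zero := rfl

theorem meetOp_flat_ne_zero {x y : Flat L} :
    meetOp S x y ≠ Flat.zero ↔ x = y ∧ x ≠ Flat.zero := by
  rw [meetOp_flat]
  split <;> simp_all

theorem meetOp_flat_self (x : Flat L) : meetOp S x x = x := by simp [meetOp_flat]

theorem binOp_flat_of (s : S.Functions 2) (a b : L) :
    binOp s (Flat.of a) (Flat.of b) = Flat.of (Structure.funMap s ![a, b]) := by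
  rw [← flatFun_of, binOp, funMap_opSym_flat]
  congr 1
  funext i
  fin_cases i <;> rfl

theorem binOp_flat_ne_zero (s : S.Functions 2) {x y : Flat L} :
    binOp s x y ≠ Flat.zero ↔ x ≠ Flat.zero ∧ y ≠ Flat.zero := by
  rw [binOp, funMap_opSym_flat, flatFun_ne_zero_iff, Fin.forall_fin_two]
  rfl

theorem realize_onTerm_flat_of {α : Type*} (t : S.Term α) (a : α → L) :
    ((LHom.sumInl : S →ᴸ flatLanguage S).onTerm t).realize (fun i => Flat.of (a i)) =
      Flat.of (t.realize a) := by
  induction t with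
  | var i => rfl
  | func f ts ih =>
    rw [Term.realize, ← flatFun_of]
    exact congrArg (flatFun f) (funext ih)

/-- Since 0 is absorbing for the operations of S, a zero argument propagates through the whole term.
This is where it matters that both variables occur in the projection term. -/
theorem realize_onTerm_flat_ne_zero {α : Type*} [DecidableEq α] (t : S.Term α) (x : α → Flat L)
    (h : ((LHom.sumInl : S →ᴸ flatLanguage S).onTerm t).realize x ≠ Flat.zero) (i : α)
    (hi : i ∈ t.varFinset) : x i ≠ Flat.zero := by
  induction t with
  | var j =>
    obtain rfl : i = j := by simpa using hi
    exact h
  | func f ts ih =>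
    simp only [Term.varFinset, Finset.mem_biUnion, Finset.mem_univ, true_and] at hi
    obtain ⟨j, hj⟩ := hi
    exact ih j ((flatFun_ne_zero_iff f _).1 h j) hj

open Classical in
-- The projection term thus tests its first argument for being nonzero, which lets finite
-- conjunctions of conditions be written as a single term.
theorem guard_flat {t : S.Term (Fin 2)} (hv : ∀ i : Fin 2, i ∈ t.varFinset)
    (ht : ∀ a b : L, t.realize ![a, b] = b) (x y : Flat L) :
    guard t x y = if x = Flat.zero then Flat.zero else y := by
  by_cases h : guard t x y = Flat.zero
  · rw [h]
    split_ifs with hx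
    · rfl
    by_contra hy
    obtain ⟨a, rfl⟩ := Flat.ne_zero_iff.1 hx
    obtain ⟨b, rfl⟩ := Flat.ne_zero_iff.1 (Ne.symm hy)
    have : (![Flat.of a, Flat.of b] : Fin 2 → Flat L) = fun i => Flat.of (![a, b] i) := by
      funext i
      fin_cases i <;> rfl
    rw [guard, this, realize_onTerm_flat_of] at h
    exact Flat.of_ne_zero _ h
  · have h0 := realize_onTerm_flat_ne_zero t _ h 0 (hv 0)
    have h1 := realize_onTerm_flat_ne_zero t _ h 1 (hv 1)
    simp only [Matrix.cons_val_zero, Matrix.cons_val_one] at h0 h1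
    rw [if_neg h0]
    obtain ⟨a, rfl⟩ := Flat.ne_zero_iff.1 h0
    obtain ⟨b, rfl⟩ := Flat.ne_zero_iff.1 h1
    have : (![Flat.of a, Flat.of b] : Fin 2 → Flat L) = fun i => Flat.of (![a, b] i) := by
      funext i
      fin_cases i <;> rfl
    rw [guard, this, realize_onTerm_flat_of, ht]

theorem guard_flat_zero {t : S.Term (Fin 2)} (hv : ∀ i : Fin 2, i ∈ t.varFinset)
    (ht : ∀ a b : L, t.realize ![a, b] = b) (y : Flat L) : guard t Flat.zero y = Flat.zero := by
  rw [guard_flat hv ht, if_pos rfl]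

theorem guard_flat_of_ne {t : S.Term (Fin 2)} (hv : ∀ i : Fin 2, i ∈ t.varFinset)
    (ht : ∀ a b : L, t.realize ![a, b] = b) {x : Flat L} (hx : x ≠ Flat.zero) (y : Flat L) :
    guard t x y = y := by
  rw [guard_flat hv ht, if_neg hx]

theorem guard_flat_ne_zero {t : S.Term (Fin 2)} (hv : ∀ i : Fin 2, i ∈ t.varFinset)
    (ht : ∀ a b : L, t.realize ![a, b] = b) {x y : Flat L} :
    guard t x y ≠ Flat.zero ↔ x ≠ Flat.zero ∧ y ≠ Flat.zero := by
  rw [guard_flat hv ht]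
  split <;> simp_all

end

end Operations

/-! ### Maps into the flat extension coded by parameters, and sufficiency of `Separable`. -/

section Approximation

open FirstOrder FirstOrder.Language

variable {S : FirstOrder.Language.{u, v}} {L : Type w} [S.Structure L]
variable {M : Type w} [(flatLanguage S).Structure M]

open Classical in
/-- The greatest element, with respect to the semilattice operation `s`, of a subset of `L`, and
`0` if there is none. -/
noncomputable def greatest (s : S.Functions 2) (X : Set L) : Flat L :=
  if h : ∃ l ∈ X, ∀ k ∈ X, Structure.funMap s ![k, l] = k then Flat.of h.choose else Flat.zero

theorem greatest_eq_of {s : S.Functions 2}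
    (hs : ∀ a b : L, Structure.funMap s ![a, b] = Structure.funMap s ![b, a]) {X : Set L} {l : L}
    (hl : l ∈ X) (h : ∀ k ∈ X, Structure.funMap s ![k, l] = k) :
    greatest s X = Flat.of l := by
  have H : ∃ l ∈ X, ∀ k ∈ X, Structure.funMap s ![k, l] = k := ⟨l, hl, h⟩
  rw [greatest, dif_pos H]
  congr 1
  rw [← h _ H.choose_spec.1, hs, H.choose_spec.2 l hl]

theorem greatest_empty (s : S.Functions 2) : greatest s (∅ : Set L) = Flat.zero := by
  simp [greatest]

/-- The map `M → L ∪ {0}` with parameters `m l` (for `l ∈ L`): the value at `x` is the greatest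
`l` such that `m l` is nonzero and below `x`. -/
noncomputable def approx (s : S.Functions 2) (m : L → M) (x : M) : Flat L :=
  greatest s {l | m l ≠ zeroOp S M ∧ binOp s (m l) x = m l}

/-- The condition on the parameters `m` saying that, on the elements `x` with `x ▷ p = p`, the map
`approx s m` has values in `L`, preserves the operations, and identifies `x` and `y` if
`(x ∧ y) ▷ p = p`, while all other elements are mapped to `0`. The condition is stated for
particular elements. -/
structure IsGoodAt (t : S.Term (Fin 2)) (s : S.Functions 2) (p : M) (m : L → M)
    (a : (Σ g : (Σ n, S.Functions n), Fin g.1) → M) (x y : M) : Prop where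
  zero : guard t (zeroOp S M) p ≠ p
  support : approx s m x = Flat.zero ↔ guard t x p ≠ p
  op : ∀ g : (Σ n, S.Functions n), approx s m (Structure.funMap (opSym g.2) fun i => a ⟨g, i⟩) =
    flatFun g.2 fun i => approx s m (a ⟨g, i⟩)
  meet : guard t (meetOp S x y) p = p →
    approx s m (meetOp S x y) = approx s m x ∧ approx s m (meetOp S x y) = approx s m y

/-- The condition of `IsGoodAt` for all elements. -/
def IsGood (t : S.Term (Fin 2)) (s : S.Functions 2) (p : M) (m : L → M) : Prop :=
  ∀ a x y, IsGoodAt t s p m a x y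

namespace IsGood

variable {t : S.Term (Fin 2)} {s : S.Functions 2} {p : M} {m : L → M}

theorem ne_zero_iff (h : IsGood t s p m) (x : M) :
    approx s m x ≠ Flat.zero ↔ guard t x p = p :=
  not_iff_comm.1 (h (fun _ => p) x x).support.symm

theorem map_op (h : IsGood t s p m) {n : ℕ} (f : S.Functions n) (x : Fin n → M) :
    approx s m (Structure.funMap (opSym f) x) = flatFun f fun i => approx s m (x i) := by
  classical
  -- The goodness condition carries one argument tuple per symbol; only that of `f` matters here,
  -- and `p` is a filler.
  let a : ∀ g : (Σ n, S.Functions n), Fin g.1 → M := Function.update (fun _ _ => p) ⟨n, f⟩ x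
  have := (h (fun q => a q.1 q.2) p p).op ⟨n, f⟩
  simpa [a] using this

variable [S.IsAlgebraic]

/-- `approx s m` preserves the values of terms, where they are mapped to nonzero elements. -/
theorem realize_eq {α : Type*} (h : IsGood t s p m) (r : (flatLanguage S).Term α) (a : α → M)
    (hr : approx s m (r.realize a) ≠ Flat.zero) :
    r.realize (fun k => approx s m (a k)) = approx s m (r.realize a) := by
  induction r with
  | var k => rfl
  | @func n f ts ih =>
    rcases f with f | f
    · change approx s m (Structure.funMap (opSym f) fun i => (ts i).realize a) ≠ _ at hr
      change Structure.funMap (opSym f) (fun i => (ts i).realize fun k => approx s m (a k)) =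
        approx s m (Structure.funMap (opSym f) fun i => (ts i).realize a)
      rw [h.map_op] at hr ⊢
      rw [funMap_opSym_flat]
      exact congrArg _ (funext fun i => ih i ((flatFun_ne_zero_iff f _).1 hr i))
    · cases f with
      | zero =>
        refine absurd ((h.ne_zero_iff _).1 hr) ?_
        exact realize_zeroSym (S := S) ts a ▸ (h (fun _ => p) p p).zero
      | meet =>
        have hM := realize_meetSym (S := S) ts a
        have hL := realize_meetSym (S := S) ts fun k => approx s m (a k)
        rw [meetSym] at hM hL
        rw [hM] at hr
        -- The nonzero hypothesis is essential here: a good map may identify two elements whose meet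
        -- is not above `p`, and then it does not preserve that meet.
        obtain ⟨h0, h1⟩ := (h (fun _ => p) _ _).meet ((h.ne_zero_iff _).1 hr)
        rw [hL, hM, ih 0 (h0 ▸ hr), ih 1 (h1 ▸ hr), ← h0, ← h1, meetOp_flat_self]

end IsGood

/-- If there are enough good maps, then a term has nonzero values under all good maps only if its
value in `M` is above `p`. -/
theorem guard_realize_eq [S.IsAlgebraic] {t : S.Term (Fin 2)} {s : S.Functions 2} {p : M}
    (hsep : ∀ x y : M, guard t x p = p → guard t y p = p → ∃ m : L → M, IsGood t s p m ∧
      (guard t (meetOp S x y) p ≠ p → approx s m x ≠ approx s m y))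
    (hp : guard t p p = p) {α : Type*} (r : (flatLanguage S).Term α) (a : α → M)
    (hr : ∀ m : L → M, IsGood t s p m → r.realize (fun k => approx s m (a k)) ≠ Flat.zero) :
    guard t (r.realize a) p = p := by
  obtain ⟨m₀, hm₀, -⟩ := hsep p p hp hp
  induction r with
  | var k => exact (hm₀.ne_zero_iff _).1 (hr m₀ hm₀)
  | @func n f ts ih =>
    rcases f with f | f
    · change guard t (Structure.funMap (opSym f) fun i => (ts i).realize a) p = p
      rw [← hm₀.ne_zero_iff, hm₀.map_op, flatFun_ne_zero_iff]
      exact fun i => (hm₀.ne_zero_iff _).2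
        (ih i fun m hm => (flatFun_ne_zero_iff f _).1 (hr m hm) i)
    · cases f with
      | zero => exact absurd rfl (hr m₀ hm₀)
      | meet =>
        have hM := realize_meetSym (S := S) ts a
        rw [meetSym] at hM
        have hL : ∀ m : L → M, IsGood t s p m →
            (ts 0).realize (fun k => approx s m (a k)) =
                (ts 1).realize (fun k => approx s m (a k)) ∧
              (ts 0).realize (fun k => approx s m (a k)) ≠ Flat.zero := by
          intro m hm
          rw [← meetOp_flat_ne_zero (S := S)]
          rw [← realize_meetSym]
          exact hr m hm
        have h0 := ih 0 fun m hm => (hL m hm).2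
        have h1 := ih 1 fun m hm => (hL m hm).1 ▸ (hL m hm).2
        rw [hM]
        -- Every good map identifies the two arguments of the meet, so a separating one cannot
        -- exist.
        by_contra hne
        obtain ⟨m, hm, H⟩ := hsep _ _ h0 h1
        refine H hne ?_
        rw [← hm.realize_eq (ts 0) a ((hm.ne_zero_iff _).2 h0),
          ← hm.realize_eq (ts 1) a ((hm.ne_zero_iff _).2 h1), (hL m hm).1]

/-- The property of `M` that characterises membership in the pseudovariety. -/
def Separable (t : S.Term (Fin 2)) (s : S.Functions 2) (L M : Type w) [S.Structure L]
    [(flatLanguage S).Structure M] : Prop :=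
  ∀ p z w : M, ∃ m : L → M, ∀ (a : (Σ g : (Σ n, S.Functions n), Fin g.1) → M) (x y : M),
    (guard t p p = p ∧ meetOp S z w = meetOp S w z ∧
      guard t (meetOp S z w) z = meetOp S z w) ∧
    (p ≠ zeroOp S M → guard t z p = p → guard t w p = p →
      IsGoodAt t s p m a x y ∧
        (guard t (meetOp S z w) p ≠ p → approx s m z ≠ approx s m w))

theorem Separable.exists_isGood {t : S.Term (Fin 2)} {s : S.Functions 2}
    (h : Separable t s L M) {p : M} (hp : p ≠ zeroOp S M) (z w : M) (hz : guard t z p = p)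
    (hw : guard t w p = p) : ∃ m : L → M, IsGood t s p m ∧
      (guard t (meetOp S z w) p ≠ p → approx s m z ≠ approx s m w) := by
  obtain ⟨m, hm⟩ := h p z w
  exact ⟨m, fun a x y => ((hm a x y).2 hp hz hw).1,
    ((hm (fun _ => p) p p).2 hp hz hw).2⟩

/-- Let p be a nonzero value of `r`. Good maps are nonzero at p, so the common value of both terms
in `Flat L` is nonzero, and `r'` is above p. The meet of the two values is then above p, since a
separating map would contradict the identity; by x ∧ y = (x ∧ y) ▷ x this meet equals p. Exchanging
the terms and using commutativity of ∧ gives equality. -/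
theorem Separable.realize_eq [S.IsAlgebraic] {t : S.Term (Fin 2)} {s : S.Functions 2}
    (h : Separable t s L M) {α : Type*} {r r' : (flatLanguage S).Term α}
    (hrr : ∀ a : α → Flat L, r.realize a = r'.realize a) (a : α → M) :
    r.realize a = r'.realize a := by
  have h1 : ∀ p : M, guard t p p = p := fun p =>
    ((h p p p).choose_spec (fun _ => p) p p).1.1
  have h2 : ∀ x y : M, meetOp S x y = meetOp S y x := fun x y =>
    ((h x x y).choose_spec (fun _ => x) x x).1.2.1
  have h3 : ∀ x y : M, guard t (meetOp S x y) x = meetOp S x y := fun x y =>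
    ((h x x y).choose_spec (fun _ => x) x x).1.2.2
  have key : ∀ {r r' : (flatLanguage S).Term α}, (∀ a : α → Flat L, r.realize a = r'.realize a) →
      r.realize a ≠ zeroOp S M → r'.realize a ≠ zeroOp S M ∧
        meetOp S (r.realize a) (r'.realize a) = r.realize a := by
    intro r r' hrr h0
    have hsep := h.exists_isGood h0
    have hr' : guard t (r'.realize a) (r.realize a) = r.realize a := by
      refine guard_realize_eq hsep (h1 _) r' a fun m hm => ?_
      rw [← hrr, hm.realize_eq r a ((hm.ne_zero_iff _).2 (h1 _))]
      exact (hm.ne_zero_iff _).2 (h1 _)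
    obtain ⟨m, hm, H⟩ := hsep _ _ (h1 _) hr'
    refine ⟨fun h' => (hm (fun _ => r.realize a) (r.realize a) (r.realize a)).zero (h' ▸ hr'), ?_⟩
    rw [← h3]
    by_contra hne
    refine H hne ?_
    rw [← hm.realize_eq r a ((hm.ne_zero_iff _).2 (h1 _)),
      ← hm.realize_eq r' a ((hm.ne_zero_iff _).2 hr'), hrr]
  by_cases h0 : r.realize a = zeroOp S M
  · by_contra hne
    exact (key (fun a => (hrr a).symm) (r := r') (r' := r) fun h' => hne (h0.trans h'.symm)).1 h0
  · obtain ⟨h0', e⟩ := key hrr h0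
    obtain ⟨-, e'⟩ := key (fun a => (hrr a).symm) (r := r') (r' := r) h0'
    rw [← e, h2, e']

end Approximation

/-! ### Finite models of the identities: existence of good maps. -/

section Models

open FirstOrder FirstOrder.Language

theorem exists_least {M : Type*} [Finite M] (b : M → M → M) (hi : ∀ x, b x x = x)
    (hc : ∀ x y, b x y = b y x) (ha : ∀ x y z, b x (b y z) = b (b x y) z) {X : Set M}
    (hX : X.Nonempty) (hb : ∀ x ∈ X, ∀ y ∈ X, b x y ∈ X) : ∃ m ∈ X, ∀ x ∈ X, b m x = m := by
  have key : ∀ Y : Set M, Y.Finite → Y ⊆ X → ∃ m ∈ X, ∀ x ∈ Y, b m x = m := by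
    intro Y hY
    induction Y, hY using Set.Finite.induction_on with
    | empty => exact fun _ => ⟨hX.some, hX.some_mem, by simp⟩
    | @insert y Y _ _ ih =>
      intro hYX
      obtain ⟨m, hm, h⟩ := ih ((Set.subset_insert _ _).trans hYX)
      refine ⟨b m y, hb _ hm _ (hYX (Set.mem_insert _ _)), ?_⟩
      rintro x (rfl | hx)
      · rw [← ha, hi]
      · rw [← ha, hc y, ha, h x hx]
  exact key X X.toFinite subset_rfl

variable {S : FirstOrder.Language.{u, v}} {L M : Type w} [S.Structure L]
variable [(flatLanguage S).Structure M] {t : S.Term (Fin 2)} {s : S.Functions 2}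

theorem foldr_guard_eq {l : List M} {p : M} (h : ∀ x ∈ l, guard t x p = p) :
    l.foldr (guard t) p = p := by
  induction l with
  | nil => rfl
  | cons x l ih =>
    rw [List.foldr_cons, ih fun y hy => h y (List.mem_cons_of_mem _ hy), h x List.mem_cons_self]

theorem realize_foldr_guardTerm {α : Type*} (l : List ((flatLanguage S).Term α))
    (r : (flatLanguage S).Term α) (a : α → M) :
    (l.foldr (guardTerm t) r).realize a =
      (l.map fun q => q.realize a).foldr (guard t) (r.realize a) := by
  induction l with
  | nil => rfl
  | cons x l ih => rw [List.foldr_cons, realize_guardTerm, ih, List.map_cons, List.foldr_cons]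

variable [S.IsAlgebraic]

/-- `M` satisfies the identities of the flat extension of `L` in variables from `M`. -/
def IsModel (S : FirstOrder.Language.{u, v}) [S.IsAlgebraic] (L M : Type w) [S.Structure L]
    [(flatLanguage S).Structure M] : Prop :=
  ∀ r r' : (flatLanguage S).Term M, (∀ a : M → Flat L, r.realize a = r'.realize a) →
    r.realize id = r'.realize id

section

variable (hv : ∀ i : Fin 2, i ∈ t.varFinset) (ht : ∀ a b : L, t.realize ![a, b] = b)
include hv ht

open Classical in
theorem foldr_guard_flat (l : List (Flat L)) (x : Flat L) :
    l.foldr (guard t) x = if ∀ y ∈ l, y ≠ Flat.zero then x else Flat.zero := by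
  induction l with
  | nil => simp
  | cons y l ih =>
    rw [List.foldr_cons, ih, guard_flat hv ht]
    by_cases hy : y = Flat.zero <;> simp [hy]

end

namespace IsModel

variable (hM : IsModel S L M)
include hM

section

variable (hv : ∀ i : Fin 2, i ∈ t.varFinset) (ht : ∀ a b : L, t.realize ![a, b] = b)
include hv ht

theorem guard_self (x : M) : guard t x x = x := by
  have := hM (guardTerm t (.var x) (.var x)) (.var x) fun a => by
    simp only [realize_guardTerm, Term.realize_var, guard_flat hv ht]
    split_ifs <;> simp_all
  simpa only [realize_guardTerm, Term.realize_var, id] using this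

theorem guard_assoc (x y z : M) : guard t (guard t x y) z = guard t x (guard t y z) := by
  have := hM (guardTerm t (guardTerm t (.var x) (.var y)) (.var z))
    (guardTerm t (.var x) (guardTerm t (.var y) (.var z))) fun a => by
    simp only [realize_guardTerm, Term.realize_var]
    by_cases h : a x = Flat.zero
    · simp only [h, guard_flat_zero hv ht]
    · simp only [guard_flat_of_ne hv ht h]
  simpa only [realize_guardTerm, Term.realize_var, id] using this

theorem guard_zero (x : M) : guard t (zeroOp S M) x = zeroOp S M := by
  have := hM (guardTerm t (zeroTerm S M) (.var x)) (zeroTerm S M) fun a => by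
    simp only [realize_guardTerm, Term.realize_var, realize_zeroTerm, guard_flat hv ht, zeroOp_flat]
    simp
  simpa only [realize_guardTerm, Term.realize_var, realize_zeroTerm, id] using this

theorem guard_meet (x y : M) : guard t (meetOp S x y) x = meetOp S x y := by
  have := hM (guardTerm t (meetTerm (.var x) (.var y)) (.var x)) (meetTerm (.var x) (.var y))
    fun a => by
    simp only [realize_guardTerm, Term.realize_var, realize_meetTerm, guard_flat hv ht, meetOp_flat]
    split_ifs <;> simp_all
  simpa only [realize_guardTerm, Term.realize_var, realize_meetTerm, id] using this

theorem guard_guard_meet (x y z : M) :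
    guard t x (guard t (meetOp S x y) z) = guard t (meetOp S x y) z := by
  have := hM (guardTerm t (.var x) (guardTerm t (meetTerm (.var x) (.var y)) (.var z)))
    (guardTerm t (meetTerm (.var x) (.var y)) (.var z)) fun a => by
    simp only [realize_guardTerm, Term.realize_var, realize_meetTerm, guard_flat hv ht, meetOp_flat]
    split_ifs <;> simp_all
  simpa only [realize_guardTerm, Term.realize_var, realize_meetTerm, id] using this

/-- In `Flat L` a value of `f` is nonzero exactly when all arguments are, so testing it amounts to
testing the arguments one after the other. -/
theorem guard_op {n : ℕ} (f : S.Functions n) (x : Fin n → M) (z : M) :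
    guard t (Structure.funMap (opSym f) x) z = (List.ofFn x).foldr (guard t) z := by
  have := hM (guardTerm t (.func (opSym f) fun i => .var (x i)) (.var z))
    ((List.ofFn fun i => (Term.var (x i) : (flatLanguage S).Term M)).foldr (guardTerm t) (.var z))
    fun a => by
    rw [realize_guardTerm, realize_foldr_guardTerm, foldr_guard_flat hv ht, guard_flat hv ht]
    have h : Structure.funMap (opSym f) (fun i => a (x i)) ≠ Flat.zero ↔ _ :=
      flatFun_ne_zero_iff f fun i => a (x i)
    have h' : (∀ y ∈ (List.ofFn fun i => (Term.var (x i) : (flatLanguage S).Term M)).map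
        (fun q => q.realize a), y ≠ Flat.zero) ↔ ∀ i, a (x i) ≠ Flat.zero := by
      simp only [List.map_ofFn, List.forall_mem_ofFn_iff, Function.comp_apply, Term.realize_var]
    by_cases H : Structure.funMap (opSym f) (fun i => a (x i)) = Flat.zero
    · rw [if_neg fun H' => h.2 (h'.1 H') H]
      exact if_pos H
    · rw [if_pos (h'.2 (h.1 H))]
      exact if_neg H
  rw [realize_guardTerm, realize_foldr_guardTerm, List.map_ofFn] at this
  exact this

theorem guard_guard_op {n : ℕ} (f : S.Functions n) (x : Fin n → M) (z : M) (i : Fin n) :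
    guard t (x i) (guard t (Structure.funMap (opSym f) x) z) =
      guard t (Structure.funMap (opSym f) x) z := by
  have := hM
    (guardTerm t (.var (x i)) (guardTerm t (.func (opSym f) fun i => .var (x i)) (.var z)))
    (guardTerm t (.func (opSym f) fun i => .var (x i)) (.var z))
    fun a => by
    simp only [realize_guardTerm, guard_flat hv ht, Term.realize_var]
    by_cases h : a (x i) = Flat.zero
    · rw [if_pos h, if_pos]
      exact flatFun_zero f _ i h
    · rw [if_neg h]
  rw [realize_guardTerm, realize_guardTerm] at this
  exact this

/-- The set of elements above `p` behaves like the set of nonzero elements of a flat extension. -/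
theorem guard_op_eq_iff {n : ℕ} (f : S.Functions n) (x : Fin n → M) (p : M) :
    guard t (Structure.funMap (opSym f) x) p = p ↔ ∀ i, guard t (x i) p = p := by
  constructor
  · intro h i
    rw [← h, hM.guard_guard_op hv ht]
  · intro h
    rw [hM.guard_op hv ht]
    exact foldr_guard_eq ((List.forall_mem_ofFn_iff).2 h)

theorem guard_bin_eq_iff (x y p : M) :
    guard t (binOp s x y) p = p ↔ guard t x p = p ∧ guard t y p = p := by
  rw [binOp, hM.guard_op_eq_iff hv ht, Fin.forall_fin_two]
  rfl

theorem guard_bin (p x y : M) : guard t p (binOp s x y) = binOp s (guard t p x) y := by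
  have := hM (guardTerm t (.var p) (binTerm s (.var x) (.var y)))
    (binTerm s (guardTerm t (.var p) (.var x)) (.var y)) fun a => by
    simp only [realize_guardTerm, realize_binTerm, guard_flat hv ht, Term.realize_var]
    split_ifs with h
    · by_contra h'
      exact ((binOp_flat_ne_zero s).1 (Ne.symm h')).1 rfl
    · rfl
  simpa only [realize_guardTerm, realize_binTerm, Term.realize_var, id] using this

end

omit hM in
theorem binOp_eq_zero (x y : Flat L) (h : x = Flat.zero ∨ y = Flat.zero) :
    binOp s x y = Flat.zero := by
  by_contra h'
  have := (binOp_flat_ne_zero s).1 h'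
  tauto

theorem guard_meet_self (x p : M) : guard t (meetOp S x x) p = guard t x p := by
  have := hM (guardTerm t (meetTerm (.var x) (.var x)) (.var p))
    (guardTerm t (.var x) (.var p)) fun a => by
    simp only [realize_guardTerm, realize_meetTerm, meetOp_flat_self]
  simpa only [realize_guardTerm, realize_meetTerm, Term.realize_var, id] using this

theorem bin_self (hi : ∀ a : L, Structure.funMap s ![a, a] = a) (x : M) : binOp s x x = x := by
  have := hM (binTerm s (.var x) (.var x)) (.var x) fun a => by
    simp only [realize_binTerm, Term.realize_var]
    rcases (a x).eq_zero_or_of with h | ⟨b, h⟩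
    · rw [h, binOp_eq_zero _ _ (.inl rfl)]
    · rw [h, binOp_flat_of, hi]
  simpa only [realize_binTerm, Term.realize_var, id] using this

theorem bin_comm (hc : ∀ a b : L, Structure.funMap s ![a, b] = Structure.funMap s ![b, a])
    (x y : M) : binOp s x y = binOp s y x := by
  have := hM (binTerm s (.var x) (.var y)) (binTerm s (.var y) (.var x)) fun a => by
    simp only [realize_binTerm, Term.realize_var]
    rcases (a x).eq_zero_or_of with h | ⟨b, h⟩
    · rw [h, binOp_eq_zero _ _ (.inl rfl), binOp_eq_zero _ _ (.inr rfl)]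
    rcases (a y).eq_zero_or_of with h' | ⟨c, h'⟩
    · rw [h', binOp_eq_zero _ _ (.inl rfl), binOp_eq_zero _ _ (.inr rfl)]
    rw [h, h', binOp_flat_of, binOp_flat_of, hc]
  simpa only [realize_binTerm, Term.realize_var, id] using this

theorem bin_assoc (ha : ∀ a b c : L, Structure.funMap s ![a, Structure.funMap s ![b, c] ] =
      Structure.funMap s ![Structure.funMap s ![a, b], c])
    (x y z : M) : binOp s x (binOp s y z) = binOp s (binOp s x y) z := by
  have := hM (binTerm s (.var x) (binTerm s (.var y) (.var z)))
    (binTerm s (binTerm s (.var x) (.var y)) (.var z)) fun a => by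
    simp only [realize_binTerm, Term.realize_var]
    rcases (a x).eq_zero_or_of with h | ⟨b, h⟩
    · simp only [h, binOp_eq_zero _ _ (.inl rfl)]
    rcases (a y).eq_zero_or_of with h' | ⟨c, h'⟩
    · simp only [h', binOp_eq_zero _ _ (.inl rfl), binOp_eq_zero _ _ (.inr rfl)]
    rcases (a z).eq_zero_or_of with h'' | ⟨d, h''⟩
    · simp only [h'', binOp_eq_zero _ _ (.inr rfl)]
    simp only [h, h', h'', binOp_flat_of, ha]
  simpa only [realize_binTerm, Term.realize_var, id] using this

theorem meet_comm (x y : M) : meetOp S x y = meetOp S y x := by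
  have := hM (meetTerm (.var x) (.var y)) (meetTerm (.var y) (.var x)) fun a => by
    simp only [realize_meetTerm, Term.realize_var, meetOp_flat]
    split_ifs <;> simp_all
  simpa only [realize_meetTerm, Term.realize_var, id] using this

/-- There are valuations of `M` in the flat extension of `L` that respect the values of finitely
many terms above `p`. -/
theorem exists_valuation (hv : ∀ i : Fin 2, i ∈ t.varFinset)
    (ht : ∀ a b : L, t.realize ![a, b] = b) {U : Set ((flatLanguage S).Term M)} (hU : U.Finite)
    {p z w : M} (hp : p ≠ zeroOp S M) (hz : guard t z p = p) (hw : guard t w p = p) :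
    ∃ a : M → Flat L, a p ≠ Flat.zero ∧
      (∀ r ∈ U, guard t (r.realize id) p = p →
        r.realize a = a (r.realize id) ∧ r.realize a ≠ Flat.zero) ∧
      (guard t (meetOp S z w) p ≠ p → a z ≠ a w) := by
  have hA : {r ∈ U | guard t (r.realize id) p = p}.Finite := hU.subset (Set.sep_subset _ _)
  let l : List ((flatLanguage S).Term M) :=
    hA.toFinset.toList.map fun r => meetTerm r (.var (r.realize id))
  -- `T` is p guarded by z, w and all r ∧ v, where v is the variable naming the value of r in M. It
  -- is nonzero under a valuation only if z, w and p are nonzero and each such r takes the nonzero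
  -- value assigned to v; under the identity valuation of M its value is p.
  let T : (flatLanguage S).Term M :=
    guardTerm t (.var z) (guardTerm t (.var w) (l.foldr (guardTerm t) (.var p)))
  have hT : T.realize id = p := by
    have : (l.foldr (guardTerm t) (.var p)).realize id = p := by
      rw [realize_foldr_guardTerm]
      refine foldr_guard_eq fun x hx => ?_
      simp only [l, List.map_map, List.mem_map, Finset.mem_toList, Set.Finite.mem_toFinset] at hx
      obtain ⟨r, hr, rfl⟩ := hx
      simp only [Function.comp_apply, realize_meetTerm, Term.realize_var, id]
      rw [hM.guard_meet_self]
      exact hr.2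
    simp only [T, realize_guardTerm, this, Term.realize_var, id, hw, hz]
  have hTa : ∀ a : M → Flat L, T.realize a ≠ Flat.zero →
      a z ≠ Flat.zero ∧ a p ≠ Flat.zero ∧ ∀ r ∈ U, guard t (r.realize id) p = p →
        r.realize a = a (r.realize id) ∧ r.realize a ≠ Flat.zero := by
    intro a ha
    simp only [T, realize_guardTerm, guard_flat_ne_zero hv ht, realize_foldr_guardTerm,
      foldr_guard_flat hv ht, Term.realize_var] at ha
    obtain ⟨haz, -, ha⟩ := ha
    split_ifs at ha with H
    · refine ⟨haz, ha, fun r hr hrp => ?_⟩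
      rw [← meetOp_flat_ne_zero (S := S)]
      refine H _ (List.mem_map.2 ⟨meetTerm r (.var (r.realize id)), List.mem_map.2 ⟨r, ?_, rfl⟩, ?_⟩)
      · simpa using ⟨hr, hrp⟩
      · rw [realize_meetTerm, Term.realize_var]
    · exact absurd rfl ha
  by_contra! H
  have hsep : ∀ a : M → Flat L, T.realize a ≠ Flat.zero →
      guard t (meetOp S z w) p ≠ p ∧ a z = a w := fun a ha =>
    H a (hTa a ha).2.1 (hTa a ha).2.2
  -- If no valuation is suitable, there are two cases. When z ∧ w is above p, `T` vanishes
  -- identically on `Flat L`, forcing p = 0. Otherwise z and w agree whenever `T` is nonzero, so (z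
  -- ∧ w) ▷ T = T is an identity and puts z ∧ w above p.
  by_cases hs : guard t (meetOp S z w) p = p
  · refine hp ?_
    have := hM T (zeroTerm S M) fun a => by
      rw [realize_zeroTerm, zeroOp_flat]
      by_contra ha
      exact (hsep a ha).1 hs
    rwa [hT, realize_zeroTerm] at this
  · refine hs ?_
    have := hM (guardTerm t (meetTerm (.var z) (.var w)) T) T fun a => by
      rw [realize_guardTerm, guard_flat hv ht, realize_meetTerm]
      by_cases ha : T.realize a = Flat.zero
      · rw [ha, ite_self]
      · rw [if_neg]
        exact meetOp_flat_ne_zero.2 ⟨(hsep a ha).2, (hTa a ha).1⟩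
    simpa only [realize_guardTerm, realize_meetTerm, hT, Term.realize_var, id] using this

/-- The valuation is taken to respect all one-step terms `opT`, `meetT` and `guardT`, finite in
number as M and the signature are finite. It is then recovered above p from the least elements of
its fibres. -/
theorem exists_isGood [Finite M] [Finite (Σ n, S.Functions n)]
    (hv : ∀ i : Fin 2, i ∈ t.varFinset) (ht : ∀ a b : L, t.realize ![a, b] = b)
    (hi : ∀ a : L, Structure.funMap s ![a, a] = a)
    (hc : ∀ a b : L, Structure.funMap s ![a, b] = Structure.funMap s ![b, a])
    (ha : ∀ a b c : L, Structure.funMap s ![a, Structure.funMap s ![b, c] ] =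
      Structure.funMap s ![Structure.funMap s ![a, b], c])
    {p z w : M} (hp : p ≠ zeroOp S M) (hz : guard t z p = p) (hw : guard t w p = p) :
    ∃ m : L → M, IsGood t s p m ∧
      (guard t (meetOp S z w) p ≠ p → approx s m z ≠ approx s m w) := by
  classical
  let opT : (Σ g : (Σ n, S.Functions n), (Fin g.1 → M)) → (flatLanguage S).Term M :=
    fun q => .func (opSym q.1.2) fun i => .var (q.2 i)
  let meetT : M × M → (flatLanguage S).Term M := fun q => meetTerm (.var q.1) (.var q.2)
  let guardT : M → (flatLanguage S).Term M := fun x => guardTerm t (.var p) (.var x)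
  obtain ⟨a, hap, haU, hasep⟩ := hM.exists_valuation hv ht
    (U := Set.range Term.var ∪ Set.range opT ∪ Set.range meetT ∪ Set.range guardT)
    ((((Set.finite_range _).union (Set.finite_range _)).union (Set.finite_range _)).union
      (Set.finite_range _)) hp hz hw
  have a_ne : ∀ x, guard t x p = p → a x ≠ Flat.zero := fun x hx =>
    (haU (.var x) (by simp) hx).2
  have a_op : ∀ {n : ℕ} (f : S.Functions n) (x : Fin n → M),
      guard t (Structure.funMap (opSym f) x) p = p →
        a (Structure.funMap (opSym f) x) = flatFun f fun i => a (x i) := fun f x hx =>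
    (haU (opT ⟨⟨_, f⟩, x⟩) (.inl (.inl (.inr ⟨_, rfl⟩))) hx).1.symm
  have a_meet : ∀ x y : M, guard t (meetOp S x y) p = p →
      meetOp S (a x) (a y) = a (meetOp S x y) ∧ meetOp S (a x) (a y) ≠ Flat.zero := fun x y h => by
    have := haU (meetT (x, y)) (.inl (.inr ⟨_, rfl⟩))
    simp only [meetT, realize_meetTerm, Term.realize_var, id] at this
    exact this h
  have a_guard : ∀ x : M, guard t x p = p → a (guard t p x) = a x := fun x hx => by
    have := haU (guardT x) (.inr ⟨_, rfl⟩)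
    simp only [guardT, realize_guardTerm, Term.realize_var, id] at this
    have h := (this (by rw [hM.guard_assoc hv ht, hx, hM.guard_self hv ht])).1
    rw [← h, guard_flat hv ht, if_neg hap]
  -- Fibres of `a` over L, restricted to elements above `p` that are fixed by p ▷ ·. Idempotence in
  -- L makes them closed under `s`.
  let X : L → Set M := fun k => {x | guard t x p = p ∧ guard t p x = x ∧ a x = Flat.of k}
  have a_bin : ∀ x y : M, guard t x p = p → guard t y p = p →
      a (binOp s x y) = binOp s (a x) (a y) := by
    intro x y hx hy
    have := a_op s ![x, y] ((hM.guard_bin_eq_iff hv ht x y p).2 ⟨hx, hy⟩)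
    rw [binOp, this, binOp, funMap_opSym_flat]
    congr 1
    exact funext (Fin.forall_fin_two.2 ⟨rfl, rfl⟩)
  have hX : ∀ k, (X k).Nonempty → ∃ m ∈ X k, ∀ x ∈ X k, binOp s m x = m := by
    intro k hk
    refine exists_least (binOp s) (hM.bin_self hi) (hM.bin_comm hc) (hM.bin_assoc ha) hk ?_
    rintro x ⟨hx1, hx2, hx3⟩ y ⟨hy1, hy2, hy3⟩
    refine ⟨(hM.guard_bin_eq_iff hv ht x y p).2 ⟨hx1, hy1⟩, ?_, ?_⟩
    · rw [hM.guard_bin hv ht, hx2]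
    · rw [a_bin x y hx1 hy1, hx3, hy3, binOp_flat_of, hi]
  -- The parameter 0 marks an empty fibre; elements above `p` are never 0, so the marking is
  -- unambiguous.
  let m : L → M := fun k => if hk : (X k).Nonempty then (hX k hk).choose else zeroOp S M
  have hm : ∀ k, m k ≠ zeroOp S M → m k ∈ X k ∧ ∀ x ∈ X k, binOp s (m k) x = m k := by
    intro k hk
    by_cases h : (X k).Nonempty
    · simp only [m, dif_pos h]
      exact (hX k h).choose_spec
    · simp [m, dif_neg h] at hk
  have hm0 : ∀ x, guard t x p = p → x ≠ zeroOp S M := by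
    rintro _ hx rfl
    rw [hM.guard_zero hv ht] at hx
    exact hp hx.symm
  have hmX : ∀ k, (X k).Nonempty → m k ≠ zeroOp S M := by
    intro k h
    simp only [m, dif_pos h]
    exact hm0 _ (hX k h).choose_spec.1.1
  have happrox0 : ∀ x, guard t x p ≠ p → approx s m x = Flat.zero := by
    intro x hx
    rw [approx, ← greatest_empty s]
    congr 1
    refine Set.eq_empty_of_forall_notMem ?_
    rintro k ⟨hk, h⟩
    refine hx ((hM.guard_bin_eq_iff (s := s) hv ht (m k) x p).1 ?_).2
    rw [h]
    exact (hm k hk).1.1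
  have happrox : ∀ x, guard t x p = p → approx s m x = a x := by
    intro x hx
    obtain ⟨k, hk⟩ := Flat.ne_zero_iff.1 (a_ne x hx)
    have hxX : guard t p x ∈ X k := by
      refine ⟨?_, ?_, (a_guard x hx).trans hk⟩
      · rw [hM.guard_assoc hv ht, hx, hM.guard_self hv ht]
      · rw [← hM.guard_assoc hv ht, hM.guard_self hv ht]
    rw [hk, approx]
    refine greatest_eq_of hc ⟨hmX k ⟨_, hxX⟩, ?_⟩ ?_
    -- The least element lies below p ▷ x; moving p ▷ across `s` onto `m k`, which it fixes, gives
    -- `m k` below x itself.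
    · have h := hm k (hmX k ⟨_, hxX⟩)
      have h2 := h.2 _ hxX
      rw [hM.bin_comm hc, ← hM.guard_bin hv ht, hM.bin_comm hc, hM.guard_bin hv ht, h.1.2.1] at h2
      exact h2
    · rintro j ⟨hj, hjx⟩
      have h := (hm j hj).1
      -- Applying `a` to the relation m j ≤ x gives j ≤ k, so k is the greatest candidate.
      have h2 := a_bin (m j) x h.1 hx
      rw [hjx, h.2.2, hk, binOp_flat_of] at h2
      exact (Flat.of_injective h2).symm
  refine ⟨m, fun b x y => ⟨?_, ⟨?_, happrox0 x⟩, ?_, ?_⟩, ?_⟩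
  · rw [hM.guard_zero hv ht]
    exact hp.symm
  · intro h h'
    exact a_ne x h' (happrox x h' ▸ h)
  · rintro ⟨n, f⟩
    dsimp only
    by_cases h : guard t (Structure.funMap (opSym f) fun i => b ⟨⟨n, f⟩, i⟩) p = p
    · rw [happrox _ h, a_op f _ h]
      congr 1
      funext i
      exact (happrox _ ((hM.guard_op_eq_iff hv ht f _ p).1 h i)).symm
    · rw [happrox0 _ h]
      rw [hM.guard_op_eq_iff hv ht, not_forall] at h
      obtain ⟨i, h⟩ := h
      exact (flatFun_zero f _ i (happrox0 _ h)).symm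
  · intro h
    have hx : guard t x p = p := by rw [← h, hM.guard_guard_meet hv ht]
    have hy : guard t y p = p := by rw [← h, hM.meet_comm, hM.guard_guard_meet hv ht]
    obtain ⟨h1, h2⟩ := a_meet x y h
    have h3 := (meetOp_flat_ne_zero.1 h2).1
    rw [happrox _ h, happrox _ hx, happrox _ hy, ← h1, ← h3, meetOp_flat_self]
    exact ⟨rfl, rfl⟩
  · intro h
    rw [happrox z hz, happrox w hw]
    exact hasep h

theorem separable [Finite M] [Finite (Σ n, S.Functions n)]
    (hv : ∀ i : Fin 2, i ∈ t.varFinset) (ht : ∀ a b : L, t.realize ![a, b] = b)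
    (hi : ∀ a : L, Structure.funMap s ![a, a] = a)
    (hc : ∀ a b : L, Structure.funMap s ![a, b] = Structure.funMap s ![b, a])
    (ha : ∀ a b c : L, Structure.funMap s ![a, Structure.funMap s ![b, c] ] =
      Structure.funMap s ![Structure.funMap s ![a, b], c]) :
    Separable t s L M := by
  intro p z w
  have h : ∃ m : L → M, p ≠ zeroOp S M → guard t z p = p → guard t w p = p →
      IsGood t s p m ∧ (guard t (meetOp S z w) p ≠ p → approx s m z ≠ approx s m w) := by
    by_cases h : p ≠ zeroOp S M ∧ guard t z p = p ∧ guard t w p = p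
    · obtain ⟨m, hm⟩ := hM.exists_isGood hv ht hi hc ha h.1 h.2.1 h.2.2
      exact ⟨m, fun _ _ _ => hm⟩
    · exact ⟨fun _ => p, fun h1 h2 h3 => absurd ⟨h1, h2, h3⟩ h⟩
  obtain ⟨m, hm⟩ := h
  exact ⟨m, fun b x y => ⟨⟨hM.guard_self hv ht p, hM.meet_comm z w, hM.guard_meet hv ht z w⟩,
    fun h1 h2 h3 => ⟨(hm h1 h2 h3).1 b x y, (hm h1 h2 h3).2⟩⟩⟩

end IsModel

end Models

/-! ### Writing `Separable` as a sentence. -/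

section Sentence

open FirstOrder FirstOrder.Language

variable {S : FirstOrder.Language.{u, v}} {L : Type w} [S.Structure L] [Finite L] {V : Type*}

/-- The coded value depends only on which k ∈ L satisfy two atomic conditions, and L is finite. -/
theorem qfDefinable_approx (s : S.Functions 2) (m : L → (flatLanguage S).Term V)
    (r : (flatLanguage S).Term V) (d : Flat L) :
    QFDefinable.{_, _, w} (flatLanguage S)
      (fun _ _ a => approx s (fun k => (m k).realize a) (r.realize a) = d) := by
  refine (QFDefinable.boolean (fun k : L =>
    (QFDefinable.equal (m k) (zeroTerm S V)).not.and
      (QFDefinable.equal (binTerm s (m k) r) (m k))) fun X => greatest s X = d).congr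
    fun M _ a => ?_
  simp only [realize_zeroTerm, realize_binTerm]
  exact Iff.rfl

/-- Every property of finitely many values of `approx` is quantifier-free definable. -/
theorem qfDefinable_approx_comp (s : S.Functions 2) (m : L → (flatLanguage S).Term V)
    {n : ℕ} (r : Fin n → (flatLanguage S).Term V) (B : (Fin n → Flat L) → Prop) :
    QFDefinable.{_, _, w} (flatLanguage S)
      (fun _ _ a => B fun i => approx s (fun k => (m k).realize a) ((r i).realize a)) := by
  have : Finite (Flat L) := inferInstanceAs (Finite (Option L))
  refine (QFDefinable.forall_finite fun d : Fin n → Flat L =>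
    (QFDefinable.forall_finite fun i => qfDefinable_approx s m (r i) (d i)).imp
      (QFDefinable.const (B d))).congr fun M _ a => ?_
  constructor
  · exact fun H => H _ fun _ => rfl
  · intro H d hd
    rwa [← funext hd]

theorem qfDefinable_isGoodAt [Finite (Σ n, S.Functions n)] (t : S.Term (Fin 2))
    (s : S.Functions 2) (p : (flatLanguage S).Term V)
    (m : L → (flatLanguage S).Term V)
    (b : (Σ g : (Σ n, S.Functions n), Fin g.1) → (flatLanguage S).Term V)
    (x y : (flatLanguage S).Term V) :
    QFDefinable.{_, _, w} (flatLanguage S) (fun _ _ a => IsGoodAt t s (p.realize a)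
      (fun k => (m k).realize a) (fun i => (b i).realize a) (x.realize a) (y.realize a)) := by
  have h1 := (QFDefinable.equal.{_, _, w} (guardTerm t (zeroTerm S V) p) p).not
  have h2 := (qfDefinable_approx_comp.{u, v, w} s m ![x] fun d => d 0 = Flat.zero).iff
    (QFDefinable.equal (guardTerm t x p) p).not
  have h3 := QFDefinable.forall_finite fun g : (Σ n, S.Functions n) =>
    qfDefinable_approx_comp.{u, v, w} s m
      (Fin.cons (Term.func (opSym g.2) fun i => b ⟨g, i⟩) fun i => b ⟨g, i⟩)
      fun d => d 0 = flatFun g.2 (Fin.tail d)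
  have h4 := (QFDefinable.equal (guardTerm t (meetTerm x y) p) p).imp
    (qfDefinable_approx_comp.{u, v, w} s m ![meetTerm x y, x, y]
      fun d => d 0 = d 1 ∧ d 0 = d 2)
  refine (h1.and (h2.and (h3.and h4))).congr fun M _ a => ?_
  simp only [realize_guardTerm, realize_zeroTerm]
  constructor
  · rintro ⟨h1, h2, h3, h4⟩
    refine ⟨h1, h2, h3, fun h => ?_⟩
    have := h4 (by rwa [realize_meetTerm])
    simpa [realize_meetTerm] using this
  · rintro ⟨h1, h2, h3, h4⟩
    refine ⟨h1, h2, h3, fun h => ?_⟩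
    have := h4 (by rwa [realize_meetTerm] at h)
    simpa [realize_meetTerm] using this

theorem exists_sentence_separable [Finite (Σ n, S.Functions n)] (t : S.Term (Fin 2))
    (s : S.Functions 2) :
    ∃ φ : (flatLanguage S).Sentence, IsAEA φ ∧
      ∀ (M : Type w) [(flatLanguage S).Structure M], M ⊨ φ ↔ Separable t s L M := by
  let A := Σ g : (Σ n, S.Functions n), Fin g.1
  -- The blocks are p, z, w (universal), the parameters m (existential), and the argument tuples
  -- with x, y (universal).
  let W := Fin 3 ⊕ L ⊕ A ⊕ Fin 2
  let p : (flatLanguage S).Term W := .var (.inl 0)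
  let z : (flatLanguage S).Term W := .var (.inl 1)
  let w : (flatLanguage S).Term W := .var (.inl 2)
  let m : L → (flatLanguage S).Term W := fun k => .var (.inr (.inl k))
  let b : A → (flatLanguage S).Term W := fun i => .var (.inr (.inr (.inl i)))
  let x : (flatLanguage S).Term W := .var (.inr (.inr (.inr 0)))
  let y : (flatLanguage S).Term W := .var (.inr (.inr (.inr 1)))
  have h1 := ((QFDefinable.equal.{_, _, w} (guardTerm t p p) p).and
    ((QFDefinable.equal (meetTerm z w) (meetTerm w z)).and
      (QFDefinable.equal (guardTerm t (meetTerm z w) z) (meetTerm z w))))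
  have h2 := (qfDefinable_isGoodAt.{u, v, w} t s p m b x y).and
    ((QFDefinable.equal (guardTerm t (meetTerm z w) p) p).not.imp
      (qfDefinable_approx_comp s m ![z, w] fun d => d 0 ≠ d 1))
  have h := h1.and ((QFDefinable.equal p (zeroTerm S W)).not.imp
    ((QFDefinable.equal (guardTerm t z p) p).imp
      ((QFDefinable.equal (guardTerm t w p) p).imp h2)))
  obtain ⟨φ, hφ, H⟩ := h.exists_isAEA
  refine ⟨φ, hφ, fun M _ => (H M).trans ?_⟩
  simp only [realize_guardTerm, realize_meetTerm, realize_zeroTerm]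
  constructor
  · intro h p z w
    obtain ⟨m, hm⟩ := h ![p, z, w]
    exact ⟨m, fun a x y => hm (Sum.elim a ![x, y])⟩
  · intro h q
    obtain ⟨m, hm⟩ := h (q 0) (q 1) (q 2)
    exact ⟨m, fun a => hm (fun i => a (.inl i)) (a (.inr 0)) (a (.inr 1))⟩

end Sentence

end FlatFO

theorem mainTheorem1 (S : FirstOrder.Language.{u, v}) [S.IsAlgebraic]
    [Finite (Σ n, S.Functions n)] (L : Type w) [S.Structure L] [Finite L] [Nonempty L]
    (hL : FlatFO.IsSemilatticeBased S L) (hp : FlatFO.HasProjectionTerm S L) :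
    ∃ φ : (FlatFO.flatLanguage S).Sentence, FlatFO.IsAEA φ ∧
      ∀ (M : Type w) [(FlatFO.flatLanguage S).Structure M] [Finite M],
        FlatFO.MemPseudovariety (FlatFO.flatLanguage S) (FlatFO.Flat L) M ↔
          FirstOrder.Language.Sentence.Realize M φ := by
  obtain ⟨s, hi, hc, ha⟩ := hL
  obtain ⟨t, hv, ht⟩ := hp
  obtain ⟨φ, hφ, H⟩ := FlatFO.exists_sentence_separable (L := L) t s
  refine ⟨φ, hφ, fun M _ _ => ?_⟩
  have : Finite (FlatFO.Flat L) := inferInstanceAs (Finite (Option L))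
  have : Nonempty (FlatFO.Flat L) := ⟨FlatFO.Flat.zero⟩
  -- The constant 0 rules out empty algebras.
  have : Nonempty M := ⟨FlatFO.zeroOp S M⟩
  rw [H, FlatFO.memPseudovariety_iff]
  exact ⟨fun h => FlatFO.IsModel.separable h hv ht hi hc ha, fun h _ _ e => h.realize_eq e id⟩
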